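/- Theorem. There are absolute constants $C_1, C_2 > 0$ such that the following holds. Let $k \ge 1$ be an integer, $\varepsilon \in (0,1]$ and $\delta \in (0, 0.5]$. Let $\mathcal{X}$ be any set of datasets with any neighboring relation, and define the sensitivity of a query $f : \mathcal{X} \to \mathbb{R}$ as $\sup |f(X) - f(X')|$ over all pairs of neighboring datasets $X, X'$. Then there is a randomized algorithm $\mathcal{A}$ that, given queries $q = (q_1, \dots, q_k)$ with $q_i : \mathcal{X} \to \mathbb{R}$ and a dataset $X \in \mathcal{X}$, outputs a random vector $\mathcal{A}(q; X) \in \mathbb{R}^k$, such that for all queries $q_1, \dots, q_k$ each of sensitivity at most one: 1. $\mathcal{A}(q; \cdot)$ is $(\varepsilon, \delta)$-differentially private, that is, for all neighboring datasets $X, X'$ and every measurable $S \subseteq \mathbb{R}^k$, $\Pr[\mathcal{A}(q; X) \in S] \le e^{\varepsilon} \Pr[\mathcal{A}(q; X') \in S] + \delta$; 2. for every dataset $X$, with probability at least $1 - C_2 / k^{10}$ the output $(a_1, \dots, a_k) = \mathcal{A}(q; X)$ satisfies $\max_{1 \le i \le k} |q_i(X) - a_i| \le C_1 \cdot \frac{1}{\varepsilon}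 \sqrt{k \log \frac{1}{\delta}}$. -/

import Mathlib

open MeasureTheory
open scoped ENNReal

/-- The sensitivity of a real-valued query `f` on datasets of type `X`: the supremum of
`|f x - f x'|` over all pairs of neighboring datasets `x`, `x'` (possibly infinite). -/
noncomputable def sensitivity {X : Type*} (Nbr : X → X → Prop) (f : X → ℝ) : ℝ≥0∞ :=
  ⨆ (x : X) (x' : X) (_ : Nbr x x'), ENNReal.ofReal |f x - f x'|

/-- `(ε, δ)`-differential privacy of a randomized algorithm that takes a dataset of type `X` to a
random output in `Y`; the algorithm is given by the distribution `M x` of its output on each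
dataset `x`. -/
def IsDP {X Y : Type*} [MeasurableSpace Y] (Nbr : X → X → Prop) (ε δ : ℝ)
    (M : X → ProbabilityMeasure Y) : Prop :=
  ∀ x x' : X, Nbr x x' → ∀ S : Set Y, MeasurableSet S →
    (M x : Measure Y).real S ≤ Real.exp ε * (M x' : Measure Y).real S + δ

/-- A randomized algorithm for answering `k` queries: from queries `q 0, …, q (k-1)` and a dataset
`x` it produces a random vector of `k` real answers, with distribution `A q x`. -/
abbrev QueryAlgorithm (X : Type*) (k : ℕ) :=
  (Fin k → X → ℝ) → X → ProbabilityMeasure (Fin k → ℝ)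

/-- The `ℓ∞` error `max_i |q_i(x) - a_i|` of the answers `a` to the queries `q` on the dataset `x`
(the norm of `Fin k → ℝ` is the sup norm). -/
noncomputable def linftyError {X : Type*} {k : ℕ} (q : Fin k → X → ℝ) (x : X) (a : Fin k → ℝ) : ℝ :=
  ‖fun i => q i x - a i‖

/-- The error bound `(1/ε) √(k log (1/δ))`. -/
noncomputable def errorBound (k : ℕ) (ε δ : ℝ) : ℝ :=
  (1 / ε) * Real.sqrt (k * Real.log (1 / δ))

/-!
The mechanism adds noise to the vector of true answers, independently of the data. Write
`L = log (1 / δ)`, `R = 1000 √(k L) / ε`, and measure the noise in units of `R`, so that a change of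
neighboring datasets is a shift by at most `η = 1 / R` in each coordinate. The noise vector `t` has
density proportional to
`(∏ i, h (t i) ^ 2) * exp (-(ε R / 2) * max (‖t‖ - 1) 0)`, `h t = max (1 - |t|) 0 + b exp (-|t|)`,
where `‖·‖` is the sup norm and `b ^ 2 = min (L / k) 1 / 16`.

*Accuracy.* A coordinate drawn with density proportional to `h ^ 2` leaves `[-1, 1]` with
probability `O (b ^ 2)`, so the exponential damping outside the unit cube only loses a factor
`exp (-8 b ^ 2 k) ≥ exp (-L / 2)` of the mass of the product density (`le_noiseMass`). On the other
hand the damping is at most `exp (-500 √(k L))` where `‖t‖ > 2`, which gives the tail bound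
(`noiseMeasure_real_norm_gt_le`).

*Privacy.* A shift changes the damping by at most `exp (ε / 2)`. For the product density, the crude
bound `h (t + s) / h t = 1 + O (η / b)` suffices for pure privacy when `k ≤ L`
(`prod_profile_sq_le_of_small_shift`). When `L ≤ k`, one bounds the moment of order `n ≈ 8 L / ε` of
the likelihood ratio. As `n η / b` is bounded, the ratio of each coordinate can be expanded to second
order. The first-order term integrates to zero, and the second-order term is `O (n² η²)` because the
Fisher information `∫ (h') ^ 2` is bounded uniformly in `b`: this is why `h ^ 2` vanishes
quadratically at the end of the tent (`integral_ratio_moment_le`). Over `k` coordinates the moment is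
thus at most `exp (O (k n² η²)) ≤ exp (L / 2)`, and by Markov's inequality the ratio exceeds
`exp (ε / 2)` with probability at most `exp (-3 L / 2)` under the product density, hence with
probability at most `exp (-L) = δ` under the noise, whose density is larger by a factor of at most
`exp (L / 2)` (`noiseMeasure_shift_le`, `scaledNoise_shift_le`).
-/

/-! ### The noise profile on the line -/

/-- The square root of the (unnormalized) density of the noise of a single coordinate, in units of
the error bound: a tent supported on `[-1, 1]` plus a Laplace tail of height `b`. The square
of the tent vanishes to second order at `±1`, which keeps the Fisher information of the density
bounded, and the tail keeps the density positive. -/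
noncomputable def profile (b t : ℝ) : ℝ := max (1 - |t|) 0 + b * Real.exp (-|t|)

/-- The total mass `∫ h ^ 2` of the density whose square root is the profile `h`. -/
noncomputable def profileMass (b : ℝ) : ℝ := ∫ t, profile b t ^ 2

lemma continuous_profile (b : ℝ) : Continuous (profile b) := by
  unfold profile; fun_prop

lemma mul_exp_neg_abs_le_profile (b t : ℝ) : b * Real.exp (-|t|) ≤ profile b t := by
  unfold profile; linarith [le_max_right (1 - |t|) 0]

lemma profile_pos {b : ℝ} (hb : 0 < b) (t : ℝ) : 0 < profile b t :=
  lt_of_lt_of_le (by positivity) (mul_exp_neg_abs_le_profile b t)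

lemma profile_le {b : ℝ} (hb : b ≤ 1) (t : ℝ) : profile b t ≤ 2 * Real.exp (-|t|) := by
  have h1 : max (1 - |t|) 0 ≤ Real.exp (-|t|) :=
    max_le (by linarith [Real.add_one_le_exp (-|t|)]) (Real.exp_pos _).le
  have h2 : b * Real.exp (-|t|) ≤ 1 * Real.exp (-|t|) := by gcongr
  unfold profile; linarith

lemma abs_exp_neg_abs_add_sub_le {t s : ℝ} (hs : |s| ≤ 1) :
    |Real.exp (-|t + s|) - Real.exp (-|t|)| ≤ 2 * |s| * Real.exp (-|t|) := by
  have h1 : |(|t| - |t + s|)| ≤ |s| := by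
    have := abs_abs_sub_abs_le t (t + s)
    simpa using this
  have h2 : Real.exp (-|t + s|) - Real.exp (-|t|)
      = (Real.exp (|t| - |t + s|) - 1) * Real.exp (-|t|) := by
    rw [sub_mul, ← Real.exp_add]; ring_nf
  rw [h2, abs_mul, abs_of_pos (Real.exp_pos _)]
  gcongr
  exact (Real.abs_exp_sub_one_le (h1.trans hs)).trans (by linarith)

lemma abs_tent_add_sub_le {t s : ℝ} (hs : |s| ≤ 1) :
    |max (1 - |t + s|) 0 - max (1 - |t|) 0| ≤ 8 * |s| * Real.exp (-|t|) := by
  rcases le_or_gt |t| 2 with ht | ht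
  · have h1 : |max (1 - |t + s|) 0 - max (1 - |t|) 0| ≤ |s| := by
      refine (abs_max_sub_max_le_abs _ _ _).trans ?_
      have := abs_abs_sub_abs_le t (t + s)
      have e : 1 - |t + s| - (1 - |t|) = |t| - |t + s| := by ring
      rw [e]; simpa using this
    have h2 : 1 ≤ 8 * Real.exp (-|t|) := by
      have h3 : Real.exp 2 ≤ 8 := by
        have : Real.exp 2 = Real.exp 1 * Real.exp 1 := by rw [← Real.exp_add]; norm_num
        nlinarith [Real.exp_one_lt_d9, Real.exp_pos 1]
      have h4 : Real.exp (-2) ≤ Real.exp (-|t|) := Real.exp_le_exp.2 (by linarith)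
      have h5 : Real.exp 2 * Real.exp (-2) = 1 := by rw [← Real.exp_add]; norm_num
      nlinarith [Real.exp_pos (-2)]
    nlinarith [abs_nonneg s]
  · have h1 : |t| - |s| ≤ |t + s| := by
      have := abs_sub_abs_le_abs_sub t (-s); simpa using this
    rw [max_eq_right (by linarith), max_eq_right (by linarith)]
    simp only [sub_self, abs_zero]; positivity

/-- The profile is Lipschitz with a constant that decays like its tail. -/
lemma abs_profile_add_sub_le {b t s : ℝ} (hb : 0 ≤ b) (hb1 : b ≤ 1) (hs : |s| ≤ 1) :
    |profile b (t + s) - profile b t| ≤ 10 * |s| * Real.exp (-|t|) := by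
  have e : profile b (t + s) - profile b t = (max (1 - |t + s|) 0 - max (1 - |t|) 0)
      + b * (Real.exp (-|t + s|) - Real.exp (-|t|)) := by unfold profile; ring
  have h1 := abs_tent_add_sub_le (t := t) hs
  have h2 := abs_exp_neg_abs_add_sub_le (t := t) hs
  have h3 : |b * (Real.exp (-|t + s|) - Real.exp (-|t|))| ≤ 1 * (2 * |s| * Real.exp (-|t|)) := by
    rw [abs_mul, abs_of_nonneg hb]; gcongr
  rw [e]
  exact (abs_add_le _ _).trans (by linarith)

lemma abs_profile_add_sub_le_mul {b η t s : ℝ} (hb : 0 < b) (hb1 : b ≤ 1) (hs : |s| ≤ η)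
    (hη : η ≤ 1) : |profile b (t + s) - profile b t| ≤ 10 * η / b * profile b t := by
  have h1 := abs_profile_add_sub_le (t := t) hb.le hb1 (hs.trans hη)
  have hη0 : 0 ≤ η := (abs_nonneg s).trans hs
  calc |profile b (t + s) - profile b t| ≤ 10 * |s| * Real.exp (-|t|) := h1
    _ ≤ 10 * η * Real.exp (-|t|) := by gcongr
    _ = 10 * η / b * (b * Real.exp (-|t|)) := by field_simp
    _ ≤ 10 * η / b * profile b t := by
      gcongr; exact mul_exp_neg_abs_le_profile b t

lemma integral_exp_neg_abs_sq : ∫ t : ℝ, Real.exp (-|t|) ^ 2 = 1 := by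
  have h1 : ∀ t : ℝ, Real.exp (-|t|) ^ 2 = Real.exp (-2 * |t|) := fun t => by
    rw [← Real.exp_nat_mul]; push_cast; ring_nf
  simp_rw [h1]
  rw [integral_comp_abs (f := fun t => Real.exp (-2 * t)), integral_exp_mul_Ioi (by norm_num)]
  norm_num

lemma integrable_exp_neg_abs_sq : Integrable fun t : ℝ => Real.exp (-|t|) ^ 2 := by
  by_contra h
  have := integral_undef h
  rw [integral_exp_neg_abs_sq] at this
  exact one_ne_zero this

lemma integrable_profile_sq {b : ℝ} (hb : 0 < b) (hb1 : b ≤ 1) :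
    Integrable fun t => profile b t ^ 2 := by
  refine (integrable_exp_neg_abs_sq.const_mul 4).mono'
    ((continuous_profile b).pow 2).aestronglyMeasurable (Filter.Eventually.of_forall fun t => ?_)
  rw [Real.norm_of_nonneg (sq_nonneg _)]
  calc profile b t ^ 2 ≤ (2 * Real.exp (-|t|)) ^ 2 :=
        pow_le_pow_left₀ (profile_pos hb t).le (profile_le hb1 t) 2
    _ = 4 * Real.exp (-|t|) ^ 2 := by ring

lemma quarter_le_profileMass {b : ℝ} (hb : 0 < b) (hb1 : b ≤ 1) : 1 / 4 ≤ profileMass b := by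
  have h1 : ∫ t in Set.Icc (-(1 / 2) : ℝ) (1 / 2), (1 / 4 : ℝ) = 1 / 4 := by
    simp; norm_num
  rw [← h1]
  refine le_trans ?_ (setIntegral_le_integral (s := Set.Icc (-(1 / 2) : ℝ) (1 / 2))
    (integrable_profile_sq hb hb1) (Filter.Eventually.of_forall fun t => sq_nonneg _))
  refine setIntegral_mono_on (by simp) (integrable_profile_sq hb hb1).integrableOn
    measurableSet_Icc fun t ht => ?_
  have h2 : |t| ≤ 1 / 2 := abs_le.2 ht
  have h3 : 1 / 2 ≤ profile b t := by
    have := le_max_left (1 - |t|) 0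
    have : 0 < b * Real.exp (-|t|) := by positivity
    unfold profile; linarith
  nlinarith

/-- The density puts mass at most `b ^ 2` outside `[-1, 1]`, where only the Laplace tail is left. -/
lemma profileMass_sub_le {b : ℝ} (hb : 0 < b) (hb1 : b ≤ 1) :
    profileMass b - b ^ 2
      ≤ ∫ t, (Set.Icc (-1 : ℝ) 1).indicator (fun t => profile b t ^ 2) t := by
  have hi := (integrable_profile_sq hb hb1).indicator (measurableSet_Icc (a := (-1 : ℝ)) (b := 1))
  have hj := integrable_exp_neg_abs_sq.const_mul (b ^ 2)
  have h1 : profileMass b ≤ ∫ t, ((Set.Icc (-1 : ℝ) 1).indicator (fun t => profile b t ^ 2) t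
      + b ^ 2 * Real.exp (-|t|) ^ 2) := by
    refine integral_mono (integrable_profile_sq hb hb1) (hi.add hj) fun t => ?_
    by_cases ht : t ∈ Set.Icc (-1 : ℝ) 1
    · simp only [Set.indicator_of_mem ht]
      linarith [show 0 ≤ b ^ 2 * Real.exp (-|t|) ^ 2 by positivity]
    · simp only [Set.indicator_of_notMem ht]
      have h2 : 1 - |t| ≤ 0 := by
        by_contra h; exact ht (abs_le.1 (by linarith))
      unfold profile; rw [max_eq_right h2]; linarith [mul_pow b (Real.exp (-|t|)) 2]
  rw [integral_add hi hj, integral_const_mul, integral_exp_neg_abs_sq] at h1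
  linarith

/-! ### Likelihood ratios of the profile under small shifts -/

/-- Second-order expansion of a negative power, with the remainder controlled as long as the
exponent times the increment is at most `1 / 2`. -/
lemma inv_one_add_pow_le {n : ℕ} (hn : 1 ≤ n) {u : ℝ} (hu : n * |u| ≤ 1 / 2) :
    ((1 + u)⁻¹) ^ n ≤ 1 - n * u + 6 * n ^ 2 * u ^ 2 := by
  have hn' : (1 : ℝ) ≤ n := by exact_mod_cast hn
  have hu' : |u| ≤ 1 / 2 := by nlinarith [abs_nonneg u]
  have hl := (abs_le.1 hu').1
  have hpos : 0 < 1 + u := by linarith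
  have h1 : (1 + u)⁻¹ ≤ Real.exp (-u + 2 * u ^ 2) := by
    refine le_trans ?_ (Real.add_one_le_exp _)
    rw [inv_le_iff_one_le_mul₀ hpos]
    nlinarith [mul_nonneg (sq_nonneg u) (by linarith : 0 ≤ 1 + 2 * u)]
  set y : ℝ := n * (-u + 2 * u ^ 2) with hy
  have h2 : ((1 + u)⁻¹) ^ n ≤ Real.exp y := by
    rw [hy, Real.exp_nat_mul]
    exact pow_le_pow_left₀ (inv_pos.2 hpos).le h1 n
  have h3 : |y| ≤ n * |u| * 2 := by
    rw [hy, abs_mul, abs_of_nonneg (by linarith : (0 : ℝ) ≤ n), mul_assoc]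
    refine mul_le_mul_of_nonneg_left ?_ (by linarith)
    have : |(-u + 2 * u ^ 2)| ≤ |u| + 2 * |u| ^ 2 := by
      refine (abs_add_le _ _).trans ?_
      rw [abs_neg, abs_of_nonneg (by positivity : (0 : ℝ) ≤ 2 * u ^ 2), sq_abs]
    nlinarith [abs_nonneg u]
  have h4 := (abs_le.1 (Real.abs_exp_sub_one_sub_id_le (x := y) (by linarith))).2
  have h5 : y ^ 2 ≤ 4 * n ^ 2 * u ^ 2 := by
    rw [← sq_abs y, ← sq_abs u]
    nlinarith [abs_nonneg y]
  have h6 : (n : ℝ) * u ^ 2 ≤ n ^ 2 * u ^ 2 := by nlinarith [sq_nonneg u]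
  rw [hy] at h4
  nlinarith

/-- Pointwise bound on the moment integrand of the likelihood ratio: the first-order term has been
rewritten as a difference of densities, which integrates to zero. -/
lemma profile_sq_mul_ratio_pow_le {b η t s : ℝ} {n : ℕ} (hb : 0 < b) (hb1 : b ≤ 1) (hs : |s| ≤ η)
    (hη : η ≤ 1) (hn : 1 ≤ n) (hnη : 20 * n * η ≤ b) :
    profile b t ^ 2 * (profile b t / profile b (t + s)) ^ n
      ≤ profile b t ^ 2 + n / 2 * (profile b t ^ 2 - profile b (t + s) ^ 2)
        + 700 * n ^ 2 * η ^ 2 * Real.exp (-|t|) ^ 2 := by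
  have hn' : (1 : ℝ) ≤ n := by exact_mod_cast hn
  have hp := profile_pos hb t
  have hη0 : 0 ≤ η := (abs_nonneg s).trans hs
  have hd := abs_profile_add_sub_le_mul (t := t) hb hb1 hs hη
  have hd2 : |profile b (t + s) - profile b t| ≤ 10 * η * Real.exp (-|t|) :=
    (abs_profile_add_sub_le hb.le hb1 (hs.trans hη)).trans (by gcongr)
  set p := profile b t
  set d := profile b (t + s) - p with hd_def
  have hps : profile b (t + s) = p + d := by rw [hd_def]; ring
  have hu : n * |d / p| ≤ 1 / 2 := by
    rw [abs_div, abs_of_pos hp]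
    calc (n : ℝ) * (|d| / p) ≤ n * (10 * η / b) := by
          refine mul_le_mul_of_nonneg_left ?_ (by linarith)
          rwa [div_le_iff₀ hp]
      _ ≤ 1 / 2 := by
          rw [← mul_div_assoc, div_le_iff₀ hb]; linarith
  have h1 := inv_one_add_pow_le hn hu
  have h2 : p / profile b (t + s) = (1 + d / p)⁻¹ := by
    rw [hps]; field_simp
  rw [h2]
  have h3 : d ^ 2 ≤ 100 * η ^ 2 * Real.exp (-|t|) ^ 2 := by
    rw [← sq_abs d]
    nlinarith [abs_nonneg d]
  calc p ^ 2 * ((1 + d / p)⁻¹) ^ n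
      ≤ p ^ 2 * (1 - n * (d / p) + 6 * n ^ 2 * (d / p) ^ 2) := by gcongr
    _ = p ^ 2 - n * (p * d) + 6 * n ^ 2 * d ^ 2 := by field_simp
    _ ≤ _ := by
      rw [hps]
      nlinarith [mul_le_mul_of_nonneg_left h3 (by positivity : (0 : ℝ) ≤ n ^ 2),
        mul_nonneg (by nlinarith : (0 : ℝ) ≤ (n : ℝ) ^ 2 - n) (sq_nonneg d),
        mul_nonneg (by positivity : (0:ℝ) ≤ (n:ℝ) ^ 2) (sq_nonneg d)]

lemma continuous_ratio_moment {b : ℝ} (hb : 0 < b) (s : ℝ) (n : ℕ) :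
    Continuous fun t => profile b t ^ 2 * (profile b t / profile b (t + s)) ^ n :=
  ((continuous_profile b).pow 2).mul (((continuous_profile b).div
    ((continuous_profile b).comp (by fun_prop)) fun t => (profile_pos hb _).ne').pow n)

/-- The `n`-th moment of the likelihood ratio of a coordinate exceeds one only to second order
in `n * η`: there is no first-order term, and no dependence on the tail height `b`. -/
lemma integral_ratio_moment_le {b η s : ℝ} {n : ℕ} (hb : 0 < b) (hb1 : b ≤ 1) (hs : |s| ≤ η)
    (hη : η ≤ 1) (hn : 1 ≤ n) (hnη : 20 * n * η ≤ b) :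
    (Integrable fun t => profile b t ^ 2 * (profile b t / profile b (t + s)) ^ n) ∧
    ∫ t, profile b t ^ 2 * (profile b t / profile b (t + s)) ^ n
      ≤ profileMass b * Real.exp (2800 * n ^ 2 * η ^ 2) := by
  have hi := integrable_profile_sq hb hb1
  have his := hi.comp_add_right s
  have hj := integrable_exp_neg_abs_sq.const_mul (700 * n ^ 2 * η ^ 2)
  have hle := fun t => profile_sq_mul_ratio_pow_le (t := t) hb hb1 hs hη hn hnη
  have hm : Integrable fun t => n / 2 * (profile b t ^ 2 - profile b (t + s) ^ 2) :=
    (hi.sub his).const_mul (n / 2)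
  have him : Integrable fun t => profile b t ^ 2
      + n / 2 * (profile b t ^ 2 - profile b (t + s) ^ 2) := hi.add hm
  have hR : Integrable fun t => profile b t ^ 2
      + n / 2 * (profile b t ^ 2 - profile b (t + s) ^ 2)
      + 700 * n ^ 2 * η ^ 2 * Real.exp (-|t|) ^ 2 := him.add hj
  have hL : Integrable fun t => profile b t ^ 2 * (profile b t / profile b (t + s)) ^ n := by
    refine hR.mono' (continuous_ratio_moment hb s n).aestronglyMeasurable
      (Filter.Eventually.of_forall fun t => ?_)
    have hp := profile_pos hb t
    have hp' := profile_pos hb (t + s)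
    rw [Real.norm_of_nonneg (by positivity)]
    exact hle t
  refine ⟨hL, (integral_mono hL hR hle).trans ?_⟩
  have hs0 : ∫ t, profile b (t + s) ^ 2 = profileMass b :=
    integral_add_right_eq_self (fun t => profile b t ^ 2) s
  have e : ∫ t, (profile b t ^ 2 + n / 2 * (profile b t ^ 2 - profile b (t + s) ^ 2)
      + 700 * n ^ 2 * η ^ 2 * Real.exp (-|t|) ^ 2) = profileMass b + 700 * n ^ 2 * η ^ 2 := by
    rw [integral_add him hj, integral_add hi hm, integral_const_mul,
      integral_const_mul, integral_sub hi his, hs0, integral_exp_neg_abs_sq]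
    unfold profileMass; ring
  refine (le_of_eq e).trans ?_
  have hW := quarter_le_profileMass hb hb1
  have := Real.add_one_le_exp (2800 * (n : ℝ) ^ 2 * η ^ 2)
  nlinarith [show 0 ≤ (n : ℝ) ^ 2 * η ^ 2 by positivity]

/-! ### The noise distribution -/

/-- The unnormalized density of the noise vector: independent coordinates with root density
`profile b`, damped exponentially at rate `κ` outside the unit cube. -/
noncomputable def noiseWeight {k : ℕ} (b κ : ℝ) (t : Fin k → ℝ) : ℝ :=
  (∏ i, profile b (t i) ^ 2) * Real.exp (-(κ * max (‖t‖ - 1) 0))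

/-- The normalizing constant of `noiseWeight`. -/
noncomputable def noiseMass (k : ℕ) (b κ : ℝ) : ℝ := ∫ t : Fin k → ℝ, noiseWeight b κ t

lemma continuous_noiseWeight {k : ℕ} (b κ : ℝ) :
    Continuous (noiseWeight b κ : (Fin k → ℝ) → ℝ) := by
  have := continuous_profile b
  unfold noiseWeight; fun_prop

lemma noiseWeight_pos {k : ℕ} {b : ℝ} (hb : 0 < b) (κ : ℝ) (t : Fin k → ℝ) :
    0 < noiseWeight b κ t :=
  mul_pos (Finset.prod_pos fun _ _ => pow_pos (profile_pos hb _) 2) (Real.exp_pos _)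

lemma noiseWeight_le_prod {k : ℕ} {b κ : ℝ} (hκ : 0 ≤ κ) (t : Fin k → ℝ) :
    noiseWeight b κ t ≤ ∏ i, profile b (t i) ^ 2 := by
  refine mul_le_of_le_one_right (Finset.prod_nonneg fun i _ => sq_nonneg _)
    (Real.exp_le_one_iff.2 ?_)
  have : 0 ≤ κ * max (‖t‖ - 1) 0 := mul_nonneg hκ (le_max_right _ _)
  linarith

lemma integrable_prod_profile_sq (k : ℕ) {b : ℝ} (hb : 0 < b) (hb1 : b ≤ 1) :
    Integrable fun t : Fin k → ℝ => ∏ i, profile b (t i) ^ 2 :=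
  Integrable.fintype_prod (f := fun _ : Fin k => fun x => profile b x ^ 2)
    fun _ => integrable_profile_sq hb hb1

lemma integral_prod_profile_sq (k : ℕ) (b : ℝ) :
    ∫ t : Fin k → ℝ, ∏ i, profile b (t i) ^ 2 = profileMass b ^ k := by
  rw [integral_fintype_prod_volume_eq_prod (fun _ : Fin k => fun x => profile b x ^ 2)]
  simp [profileMass]

lemma integrable_noiseWeight (k : ℕ) {b κ : ℝ} (hb : 0 < b) (hb1 : b ≤ 1) (hκ : 0 ≤ κ) :
    Integrable (noiseWeight b κ : (Fin k → ℝ) → ℝ) := by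
  refine (integrable_prod_profile_sq k hb hb1).mono'
    (continuous_noiseWeight b κ).aestronglyMeasurable (Filter.Eventually.of_forall fun t => ?_)
  rw [Real.norm_of_nonneg (noiseWeight_pos hb κ t).le]
  exact noiseWeight_le_prod hκ t

/-- Damping the product density outside the unit cube loses at most a factor `exp (-8 b² k)` of its
mass, since each coordinate lies outside `[-1, 1]` with probability `O (b²)`. -/
lemma le_noiseMass (k : ℕ) {b κ : ℝ} (hb : 0 < b) (hb1 : b ≤ 1 / 4) (hκ : 0 ≤ κ) :
    profileMass b ^ k * Real.exp (-(8 * b ^ 2 * k)) ≤ noiseMass k b κ := by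
  have hb1' : b ≤ 1 := by linarith
  have hW := quarter_le_profileMass hb hb1'
  have hcore := profileMass_sub_le hb hb1'
  have hfac : profileMass b * Real.exp (-(8 * b ^ 2)) ≤ profileMass b - b ^ 2 := by
    -- `exp (-2x) ≤ 1 - x` for `x = 4 b² ≤ 1 / 4`
    have h1 : Real.exp (-(8 * b ^ 2)) ≤ 1 - 4 * b ^ 2 := by
      have hx : 8 * b ^ 2 ≤ 1 / 2 := by nlinarith
      have h2 := (abs_le.1 (Real.abs_exp_sub_one_sub_id_le (x := -(8 * b ^ 2))
        (by rw [abs_neg, abs_of_nonneg (by positivity)]; linarith))).2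
      nlinarith [mul_nonneg (sq_nonneg b) (sub_nonneg.2 hx)]
    nlinarith [sq_nonneg b]
  have hind : Integrable fun t : Fin k → ℝ =>
      ∏ i, (Set.Icc (-1 : ℝ) 1).indicator (fun t => profile b t ^ 2) (t i) :=
    Integrable.fintype_prod
      (f := fun _ : Fin k => (Set.Icc (-1 : ℝ) 1).indicator (fun t => profile b t ^ 2))
      fun _ => (integrable_profile_sq hb hb1').indicator measurableSet_Icc
  have hprod : ∫ t : Fin k → ℝ,
      ∏ i, (Set.Icc (-1 : ℝ) 1).indicator (fun t => profile b t ^ 2) (t i)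
      = (∫ t, (Set.Icc (-1 : ℝ) 1).indicator (fun t => profile b t ^ 2) t) ^ k := by
    rw [integral_fintype_prod_volume_eq_prod
      (fun _ : Fin k => (Set.Icc (-1 : ℝ) 1).indicator (fun t => profile b t ^ 2))]
    simp
  calc profileMass b ^ k * Real.exp (-(8 * b ^ 2 * k))
      = (profileMass b * Real.exp (-(8 * b ^ 2))) ^ k := by
        rw [mul_pow, ← Real.exp_nat_mul]; ring_nf
    _ ≤ (∫ t, (Set.Icc (-1 : ℝ) 1).indicator (fun t => profile b t ^ 2) t) ^ k :=
        pow_le_pow_left₀ (by positivity) (hfac.trans hcore) k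
    _ = ∫ t : Fin k → ℝ, ∏ i, (Set.Icc (-1 : ℝ) 1).indicator (fun t => profile b t ^ 2) (t i) :=
        hprod.symm
    _ ≤ noiseMass k b κ := by
        refine integral_mono hind (integrable_noiseWeight k hb hb1' hκ) fun t => ?_
        by_cases ht : ∀ i, t i ∈ Set.Icc (-1 : ℝ) 1
        · have hn : ‖t‖ ≤ 1 := (pi_norm_le_iff_of_nonneg zero_le_one).2 fun i => abs_le.2 (ht i)
          simp only [noiseWeight, max_eq_right (sub_nonpos.2 hn), mul_zero, neg_zero,
            Real.exp_zero, mul_one]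
          exact (Finset.prod_congr rfl fun i _ => Set.indicator_of_mem (ht i) _).le
        · obtain ⟨i, hi⟩ := not_forall.1 ht
          refine le_trans (le_of_eq ?_) (noiseWeight_pos hb κ t).le
          exact Finset.prod_eq_zero (Finset.mem_univ i) (Set.indicator_of_notMem hi _)

lemma noiseMass_pos (k : ℕ) {b κ : ℝ} (hb : 0 < b) (hb1 : b ≤ 1 / 4) (hκ : 0 ≤ κ) :
    0 < noiseMass k b κ := by
  have := quarter_le_profileMass hb (by linarith)
  exact lt_of_lt_of_le (by positivity) (le_noiseMass k hb hb1 hκ)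

lemma profileMass_pow_div_noiseMass_le (k : ℕ) {b κ : ℝ} (hb : 0 < b) (hb1 : b ≤ 1 / 4)
    (hκ : 0 ≤ κ) : profileMass b ^ k / noiseMass k b κ ≤ Real.exp (8 * b ^ 2 * k) := by
  rw [div_le_iff₀ (noiseMass_pos k hb hb1 hκ)]
  have h := mul_le_mul_of_nonneg_left (le_noiseMass k hb hb1 hκ)
    (Real.exp_pos (8 * b ^ 2 * k)).le
  rwa [mul_left_comm, ← Real.exp_add, add_neg_cancel, Real.exp_zero, mul_one] at h

/-- The distribution on `ℝ ^ k` with density proportional to `noiseWeight`. -/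
noncomputable def noiseMeasure (k : ℕ) (b κ : ℝ) : Measure (Fin k → ℝ) :=
  volume.withDensity fun t => ENNReal.ofReal (noiseWeight b κ t / noiseMass k b κ)

lemma noiseMeasure_real (k : ℕ) {b κ : ℝ} (hb : 0 < b) (hb1 : b ≤ 1 / 4) (hκ : 0 ≤ κ)
    {T : Set (Fin k → ℝ)} (hT : MeasurableSet T) :
    (noiseMeasure k b κ).real T = ∫ t in T, noiseWeight b κ t / noiseMass k b κ := by
  have hZ := noiseMass_pos k hb hb1 hκ
  rw [measureReal_def, noiseMeasure, withDensity_apply _ hT,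
    ← integral_eq_lintegral_of_nonneg_ae]
  · exact Filter.Eventually.of_forall fun t => (div_pos (noiseWeight_pos hb κ t) hZ).le
  · exact ((continuous_noiseWeight b κ).div_const _).aestronglyMeasurable

lemma isProbabilityMeasure_noiseMeasure (k : ℕ) {b κ : ℝ} (hb : 0 < b) (hb1 : b ≤ 1 / 4)
    (hκ : 0 ≤ κ) : IsProbabilityMeasure (noiseMeasure k b κ) := by
  have hZ := noiseMass_pos k hb hb1 hκ
  constructor
  rw [noiseMeasure, withDensity_apply _ MeasurableSet.univ, Measure.restrict_univ,
    ← ofReal_integral_eq_lintegral_ofReal ((integrable_noiseWeight k hb (by linarith) hκ).div_const _)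
      (Filter.Eventually.of_forall fun t => (div_pos (noiseWeight_pos hb κ t) hZ).le),
    integral_div]
  change ENNReal.ofReal (noiseMass k b κ / noiseMass k b κ) = 1
  rw [div_self hZ.ne', ENNReal.ofReal_one]

/-- Outside the cube of radius two the damping outweighs the normalization. -/
lemma noiseMeasure_real_norm_gt_le (k : ℕ) {b κ : ℝ} (hb : 0 < b) (hb1 : b ≤ 1 / 4)
    (hκ : 0 ≤ κ) :
    (noiseMeasure k b κ).real {t | 2 < ‖t‖} ≤ Real.exp (8 * b ^ 2 * k - κ) := by
  have hZ := noiseMass_pos k hb hb1 hκ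
  have hi := integrable_prod_profile_sq k hb (by linarith : b ≤ 1)
  have hT : MeasurableSet {t : Fin k → ℝ | 2 < ‖t‖} :=
    (isOpen_lt continuous_const continuous_norm).measurableSet
  rw [noiseMeasure_real k hb hb1 hκ hT]
  have hi' : Integrable fun t : Fin k → ℝ =>
      (∏ i, profile b (t i) ^ 2) * (Real.exp (-κ) / noiseMass k b κ) := hi.mul_const _
  calc ∫ t in {t : Fin k → ℝ | 2 < ‖t‖}, noiseWeight b κ t / noiseMass k b κ
      ≤ ∫ t in {t : Fin k → ℝ | 2 < ‖t‖},
          (∏ i, profile b (t i) ^ 2) * (Real.exp (-κ) / noiseMass k b κ) := by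
        refine setIntegral_mono_on
          ((integrable_noiseWeight k hb (by linarith) hκ).div_const _).integrableOn
          hi'.integrableOn hT fun t ht => ?_
        rw [← mul_div_assoc, noiseWeight]
        have ht' : 2 < ‖t‖ := ht
        have h1 : 1 ≤ max (‖t‖ - 1) 0 := le_max_of_le_left (by linarith)
        gcongr
        nlinarith
    _ ≤ ∫ t : Fin k → ℝ, (∏ i, profile b (t i) ^ 2) * (Real.exp (-κ) / noiseMass k b κ) :=
        setIntegral_le_integral hi' (Filter.Eventually.of_forall fun t =>
          mul_nonneg (Finset.prod_nonneg fun i _ => sq_nonneg _)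
            (div_pos (Real.exp_pos _) hZ).le)
    _ = profileMass b ^ k / noiseMass k b κ * Real.exp (-κ) := by
        rw [integral_mul_const, integral_prod_profile_sq]; ring
    _ ≤ Real.exp (8 * b ^ 2 * k) * Real.exp (-κ) := by
        gcongr; exact profileMass_pow_div_noiseMass_le k hb hb1 hκ
    _ = Real.exp (8 * b ^ 2 * k - κ) := by rw [← Real.exp_add]; ring_nf

/-! ### Privacy of the noise under shifts -/

lemma exp_neg_damping_le {k : ℕ} {κ η : ℝ} (hκ : 0 ≤ κ) {t s : Fin k → ℝ} (hs : ‖s‖ ≤ η) :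
    Real.exp (-(κ * max (‖t‖ - 1) 0))
      ≤ Real.exp (κ * η) * Real.exp (-(κ * max (‖t + s‖ - 1) 0)) := by
  rw [← Real.exp_add, Real.exp_le_exp]
  have h1 : max (‖t + s‖ - 1) 0 ≤ max (‖t‖ - 1) 0 + η :=
    max_le (by linarith [norm_add_le t s, le_max_left (‖t‖ - 1) 0])
      (by linarith [le_max_right (‖t‖ - 1) 0, norm_nonneg s])
  nlinarith

/-- If the likelihood ratio of the product densities is at most `exp a` up to an additive error
`E` that integrates to at most `δ` times the normalizing constant, then the noise is private under
the shift `s`. -/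
lemma noiseMeasure_shift_le (k : ℕ) {b κ η a δ : ℝ} (hb : 0 < b) (hb1 : b ≤ 1 / 4)
    (hκ : 0 ≤ κ) {s : Fin k → ℝ} (hs : ‖s‖ ≤ η) {E : (Fin k → ℝ) → ℝ} (hE : Integrable E)
    (hE0 : ∀ t, 0 ≤ E t) (hEδ : ∫ t, E t ≤ δ * noiseMass k b κ)
    (hratio : ∀ t : Fin k → ℝ, ∏ i, profile b (t i) ^ 2
      ≤ max (Real.exp a * ∏ i, profile b ((t + s) i) ^ 2) (E t))
    {T : Set (Fin k → ℝ)} (hT : MeasurableSet T) :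
    (noiseMeasure k b κ).real T
      ≤ Real.exp (a + κ * η) * (noiseMeasure k b κ).real {t | t - s ∈ T} + δ := by
  have hZ := noiseMass_pos k hb hb1 hκ
  have hF := integrable_noiseWeight k hb (by linarith : b ≤ 1) hκ
  have hFs : Integrable fun t => noiseWeight b κ (t + s) := hF.comp_add_right s
  have hTs : MeasurableSet {t | t - s ∈ T} := (measurable_id.sub_const s) hT
  have hpt : ∀ t, noiseWeight b κ t / noiseMass k b κ
      ≤ Real.exp (a + κ * η) * (noiseWeight b κ (t + s) / noiseMass k b κ)
        + E t / noiseMass k b κ := fun t => by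
    rw [← mul_div_assoc, ← add_div]
    gcongr
    rcases le_max_iff.1 (hratio t) with h | h
    · have h2 : noiseWeight b κ t ≤ (Real.exp a * ∏ i, profile b ((t + s) i) ^ 2) *
          (Real.exp (κ * η) * Real.exp (-(κ * max (‖t + s‖ - 1) 0))) :=
        mul_le_mul h (exp_neg_damping_le hκ hs) (Real.exp_pos _).le
          (mul_nonneg (Real.exp_pos _).le (Finset.prod_nonneg fun i _ => sq_nonneg _))
      have e : (Real.exp a * ∏ i, profile b ((t + s) i) ^ 2) *
          (Real.exp (κ * η) * Real.exp (-(κ * max (‖t + s‖ - 1) 0)))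
          = Real.exp (a + κ * η) * noiseWeight b κ (t + s) := by
        rw [Real.exp_add, noiseWeight]; ring
      linarith [hE0 t]
    · have := mul_pos (Real.exp_pos (a + κ * η)) (noiseWeight_pos hb κ (t + s))
      linarith [noiseWeight_le_prod (b := b) hκ t]
  have hshift : (noiseMeasure k b κ).real {t | t - s ∈ T}
      = ∫ t in T, noiseWeight b κ (t + s) / noiseMass k b κ := by
    rw [noiseMeasure_real k hb hb1 hκ hTs, ← integral_indicator hTs, ← integral_indicator hT,
      ← integral_add_right_eq_self _ s]
    refine integral_congr_ae (Filter.Eventually.of_forall fun t => ?_)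
    have e : t + s ∈ {t | t - s ∈ T} ↔ t ∈ T := by
      rw [Set.mem_ofPred_eq, add_sub_cancel_right]
    by_cases ht : t ∈ T
    · simp only [Set.indicator_of_mem ht, Set.indicator_of_mem (e.2 ht)]
    · simp only [Set.indicator_of_notMem ht, Set.indicator_of_notMem (mt e.1 ht)]
  have hi1 : Integrable fun t => Real.exp (a + κ * η) *
      (noiseWeight b κ (t + s) / noiseMass k b κ) := (hFs.div_const _).const_mul _
  have hi2 : Integrable fun t => E t / noiseMass k b κ := hE.div_const _
  rw [hshift, noiseMeasure_real k hb hb1 hκ hT]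
  calc ∫ t in T, noiseWeight b κ t / noiseMass k b κ
      ≤ ∫ t in T, (Real.exp (a + κ * η) * (noiseWeight b κ (t + s) / noiseMass k b κ)
        + E t / noiseMass k b κ) :=
        setIntegral_mono (hF.div_const _).integrableOn (hi1.add hi2).integrableOn hpt
    _ = Real.exp (a + κ * η) * (∫ t in T, noiseWeight b κ (t + s) / noiseMass k b κ)
        + ∫ t in T, E t / noiseMass k b κ := by
        rw [integral_add hi1.integrableOn hi2.integrableOn, integral_const_mul]
    _ ≤ Real.exp (a + κ * η) * (∫ t in T, noiseWeight b κ (t + s) / noiseMass k b κ) + δ := by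
        gcongr
        refine (setIntegral_le_integral hi2
          (Filter.Eventually.of_forall fun t => div_nonneg (hE0 t) hZ.le)).trans ?_
        rwa [integral_div, div_le_iff₀ hZ]

/-- A tail of constant height makes the noise purely private under shifts of size `O (1 / k)`. -/
lemma prod_profile_sq_le_of_small_shift (k : ℕ) {b η : ℝ} (hb : 0 < b) (hb1 : b ≤ 1)
    (hη : 20 * η ≤ b) {s : Fin k → ℝ} (hs : ‖s‖ ≤ η) (t : Fin k → ℝ) :
    ∏ i, profile b (t i) ^ 2
      ≤ Real.exp (40 * k * η / b) * ∏ i, profile b ((t + s) i) ^ 2 := by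
  have hη0 : 0 ≤ η := (norm_nonneg s).trans hs
  have e : Real.exp (40 * k * η / b) = ∏ _i : Fin k, Real.exp (20 * η / b) ^ 2 := by
    rw [Finset.prod_const, Finset.card_univ, Fintype.card_fin, ← Real.exp_nat_mul,
      ← Real.exp_nat_mul]
    push_cast; ring_nf
  rw [e, ← Finset.prod_mul_distrib]
  refine Finset.prod_le_prod (fun i _ => sq_nonneg _) fun i _ => ?_
  rw [← mul_pow]
  refine pow_le_pow_left₀ (profile_pos hb _).le ?_ 2
  have h1 := (abs_le.1 (abs_profile_add_sub_le_mul (t := t i) hb hb1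
    ((norm_le_pi_norm s i).trans hs) (by linarith))).1
  have h2 := Real.add_one_le_exp (20 * η / b)
  have h3 : 10 * η / b ≤ 1 / 2 := by rw [div_le_iff₀ hb]; linarith
  have h3' : 0 ≤ 10 * η / b := by positivity
  have h4 : 20 * η / b = 2 * (10 * η / b) := by ring
  have hp := profile_pos hb (t i)
  have hp' := profile_pos hb ((t + s) i)
  rw [h4] at h2 ⊢
  set x := 10 * η / b
  change _ ≤ profile b ((t + s) i) - _ at h1
  -- `1 ≤ (1 + 2x) (1 - x)` for `0 ≤ x ≤ 1 / 2`
  have h5 : (1 - x) * profile b (t i) ≤ profile b ((t + s) i) := by linarith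
  calc profile b (t i) ≤ (1 + 2 * x) * ((1 - x) * profile b (t i)) := by
        nlinarith [mul_nonneg (mul_nonneg h3' (by linarith : 0 ≤ 1 - 2 * x)) hp.le]
    _ ≤ Real.exp (2 * x) * profile b ((t + s) i) := by
        refine mul_le_mul (by linarith) h5 ?_ (Real.exp_pos _).le
        exact mul_nonneg (by linarith) hp.le

/-- Markov's inequality for the `n`-th moment of the likelihood ratio, in pointwise form: where the
ratio of the product densities exceeds `exp a`, its moment integrand dominates. -/
lemma prod_profile_sq_le_max (k : ℕ) {b a : ℝ} (hb : 0 < b) (n : ℕ) (s t : Fin k → ℝ) :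
    ∏ i, profile b (t i) ^ 2 ≤ max (Real.exp a * ∏ i, profile b ((t + s) i) ^ 2)
      (Real.exp (-(n * (a / 2))) *
        ∏ i, profile b (t i) ^ 2 * (profile b (t i) / profile b (t i + s i)) ^ n) := by
  rw [le_max_iff]
  have hp : ∀ x, 0 < profile b x := profile_pos hb
  set P := ∏ i, profile b (t i) with hP
  set Q := ∏ i, profile b ((t + s) i) with hQ
  have hP0 : 0 < P := Finset.prod_pos fun i _ => hp _
  have hQ0 : 0 < Q := Finset.prod_pos fun i _ => hp _
  have e : ∏ i, profile b (t i) ^ 2 * (profile b (t i) / profile b (t i + s i)) ^ n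
      = P ^ 2 * (P / Q) ^ n := by
    rw [Finset.prod_mul_distrib, Finset.prod_pow, Finset.prod_pow, Finset.prod_div_distrib]
    rfl
  rw [e, Finset.prod_pow, Finset.prod_pow, ← hP, ← hQ]
  have ea : Real.exp a = Real.exp (a / 2) ^ 2 := by
    rw [← Real.exp_nat_mul]; push_cast; ring_nf
  rcases le_total P (Real.exp (a / 2) * Q) with h | h
  · left
    rw [ea, ← mul_pow]
    exact pow_le_pow_left₀ hP0.le h 2
  · right
    have h1 : Real.exp (n * (a / 2)) ≤ (P / Q) ^ n := by
      rw [Real.exp_nat_mul]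
      exact pow_le_pow_left₀ (Real.exp_pos _).le ((le_div_iff₀ hQ0).2 h) n
    calc P ^ 2 = Real.exp (-(n * (a / 2))) * (P ^ 2 * Real.exp (n * (a / 2))) := by
          rw [mul_left_comm, ← Real.exp_add]; simp
      _ ≤ _ := by gcongr

lemma integral_prod_ratio_moment_le (k : ℕ) {b η : ℝ} {n : ℕ} {s : Fin k → ℝ} (hb : 0 < b)
    (hb1 : b ≤ 1) (hs : ‖s‖ ≤ η) (hη : η ≤ 1) (hn : 1 ≤ n) (hnη : 20 * n * η ≤ b) :
    (Integrable fun t : Fin k → ℝ =>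
      ∏ i, profile b (t i) ^ 2 * (profile b (t i) / profile b (t i + s i)) ^ n) ∧
    ∫ t : Fin k → ℝ, ∏ i, profile b (t i) ^ 2 * (profile b (t i) / profile b (t i + s i)) ^ n
      ≤ profileMass b ^ k * Real.exp (2800 * k * n ^ 2 * η ^ 2) := by
  have h := fun i => integral_ratio_moment_le (s := s i) hb hb1 ((norm_le_pi_norm s i).trans hs)
    hη hn hnη
  refine ⟨Integrable.fintype_prod (f := fun i : Fin k => fun x =>
    profile b x ^ 2 * (profile b x / profile b (x + s i)) ^ n) fun i => (h i).1, ?_⟩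
  rw [integral_fintype_prod_volume_eq_prod (fun i : Fin k => fun x =>
    profile b x ^ 2 * (profile b x / profile b (x + s i)) ^ n)]
  have hp : ∀ x, 0 < profile b x := profile_pos hb
  refine (Finset.prod_le_prod (fun i _ => integral_nonneg fun x => ?_) fun i _ => (h i).2).trans
    (le_of_eq ?_)
  · have := hp x
    have := hp (x + s i)
    positivity
  · rw [Finset.prod_const, Finset.card_univ, Fintype.card_fin, mul_pow, ← Real.exp_nat_mul]
    ring_nf

/-! ### Choice of parameters -/

/-- The tail height used for `k` queries and privacy parameter `δ = exp (-L)`. Its square is of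
order `min (L / k, 1)`: large enough for the likelihood ratios of single coordinates to be bounded
by `1 + O (1 / min L k)`, small enough for the normalization to cost only a factor `exp (L / 2)`. -/
noncomputable def tailHeight (k : ℕ) (L : ℝ) : ℝ := Real.sqrt (min (L / k) 1) / 4

lemma tailHeight_pos {k : ℕ} (hk : 1 ≤ k) {L : ℝ} (hL : 0 < L) : 0 < tailHeight k L := by
  have hk' : (0 : ℝ) < k := by exact_mod_cast hk
  have : 0 < min (L / k) 1 := lt_min (by positivity) one_pos
  unfold tailHeight; positivity

lemma tailHeight_le (k : ℕ) (L : ℝ) : tailHeight k L ≤ 1 / 4 := by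
  have : Real.sqrt (min (L / k) 1) ≤ 1 := Real.sqrt_le_one.2 (min_le_right _ _)
  unfold tailHeight; linarith

lemma tailHeight_of_le {k : ℕ} (hk : 1 ≤ k) {L : ℝ} (h : k ≤ L) : tailHeight k L = 1 / 4 := by
  have hk' : (0 : ℝ) < k := by exact_mod_cast hk
  rw [tailHeight, min_eq_right ((one_le_div hk').2 h), Real.sqrt_one]

lemma eight_mul_tailHeight_sq_mul {k : ℕ} (hk : 1 ≤ k) {L : ℝ} (hL : 0 < L) :
    8 * tailHeight k L ^ 2 * k = min L k / 2 := by
  have hk' : (0 : ℝ) < k := by exact_mod_cast hk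
  rw [tailHeight, div_pow, Real.sq_sqrt (le_min (by positivity) zero_le_one)]
  rcases le_total L k with h | h
  · rw [min_eq_left h, min_eq_left ((div_le_one hk').2 h)]; field_simp; norm_num
  · rw [min_eq_right h, min_eq_right ((one_le_div hk').2 h)]; ring

lemma tailHeight_of_ge {k : ℕ} (hk : 1 ≤ k) {L : ℝ} (hL : 0 < L) (h : L ≤ k) :
    tailHeight k L = L / (4 * Real.sqrt (k * L)) := by
  have hk' : (0 : ℝ) < k := by exact_mod_cast hk
  have hr : 0 < Real.sqrt (k * L) := Real.sqrt_pos.2 (by positivity)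
  rw [tailHeight, min_eq_left ((div_le_one hk').2 h)]
  have h1 : Real.sqrt (L / k) * Real.sqrt (k * L) = L := by
    rw [← Real.sqrt_mul (by positivity), show L / k * (k * L) = L ^ 2 by field_simp,
      Real.sqrt_sq hL.le]
  rw [div_eq_div_iff (by norm_num) (by positivity)]
  linarith

/-- The noise scale: half of the bound on the error. -/
noncomputable def noiseScale (k : ℕ) (ε L : ℝ) : ℝ := 1000 * Real.sqrt (k * L) / ε

lemma noiseScale_pos {k : ℕ} (hk : 1 ≤ k) {ε L : ℝ} (hε : 0 < ε) (hL : 0 < L) :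
    0 < noiseScale k ε L := by
  have hk' : (0 : ℝ) < k := by exact_mod_cast hk
  unfold noiseScale; positivity

/-- The noise distribution in units of `noiseScale`. The damping rate `ε R / 2` lets the damping
factor change by at most `exp (ε / 2)` under a shift by `1 / R`. -/
noncomputable def scaledNoise (k : ℕ) (ε L : ℝ) : Measure (Fin k → ℝ) :=
  noiseMeasure k (tailHeight k L) (ε * noiseScale k ε L / 2)

lemma scaledNoise_shift_le {k : ℕ} (hk : 1 ≤ k) {ε L : ℝ} (hε : 0 < ε) (hε1 : ε ≤ 1)
    (hL : 1 / 2 ≤ L) {s : Fin k → ℝ} (hs : ‖s‖ ≤ (noiseScale k ε L)⁻¹)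
    {T : Set (Fin k → ℝ)} (hT : MeasurableSet T) :
    (scaledNoise k ε L).real T
      ≤ Real.exp ε * (scaledNoise k ε L).real {t | t - s ∈ T} + Real.exp (-L) := by
  have hL0 : 0 < L := by linarith
  have hk' : (1 : ℝ) ≤ k := by exact_mod_cast hk
  have hR := noiseScale_pos hk hε hL0
  have hb := tailHeight_pos hk hL0
  have hb1 := tailHeight_le k L
  have hκ : 0 ≤ ε * noiseScale k ε L / 2 := by positivity
  have hexp : ε / 2 + ε * noiseScale k ε L / 2 * (noiseScale k ε L)⁻¹ = ε := by
    field_simp; norm_num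
  have hr : 0 < Real.sqrt (k * L) := Real.sqrt_pos.2 (by positivity)
  have hr2 : Real.sqrt (k * L) ^ 2 = k * L := Real.sq_sqrt (by positivity)
  have hη : (noiseScale k ε L)⁻¹ = ε / (1000 * Real.sqrt (k * L)) := by
    rw [noiseScale, inv_div]
  unfold scaledNoise
  rcases le_total (k : ℝ) L with hkL | hkL
  · have hrk : k ≤ Real.sqrt (k * L) := Real.le_sqrt_of_sq_le (by nlinarith)
    have hb4 := tailHeight_of_le hk hkL
    have h1 : k * (noiseScale k ε L)⁻¹ ≤ ε / 1000 := by
      rw [hη, ← mul_div_assoc, div_le_div_iff₀ (by positivity) (by norm_num)]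
      nlinarith
    have hη0 : 0 < (noiseScale k ε L)⁻¹ := by positivity
    have h := noiseMeasure_shift_le k (a := ε / 2) (δ := Real.exp (-L)) (E := fun _ => 0)
      hb hb1 hκ hs (integrable_zero _ _ _) (fun _ => le_rfl)
      (by
        rw [integral_zero]
        exact (mul_pos (Real.exp_pos _) (noiseMass_pos k hb hb1 hκ)).le)
      (fun t => le_max_of_le_left ?_) hT
    · rwa [hexp] at h
    · refine (prod_profile_sq_le_of_small_shift k hb (by linarith) ?_ hs t).trans ?_
      · rw [hb4]; nlinarith
      · refine mul_le_mul_of_nonneg_right (Real.exp_le_exp.2 ?_)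
          (Finset.prod_nonneg fun i _ => sq_nonneg _)
        rw [hb4, div_le_iff₀ (by norm_num)]
        linarith
  · have hbr := tailHeight_of_ge hk hL0 hkL
    -- with this order of the moment, the factor `exp (-n ε / 4)` of Markov's inequality is at most
    -- `exp (-2 L)`, which pays for the moment and the normalization, `exp (L / 2)` each
    set n : ℕ := ⌈8 * L / ε⌉₊ with hn_def
    have hn8 : 8 * L ≤ n * ε := by
      have := Nat.le_ceil (8 * L / ε)
      rwa [div_le_iff₀ hε] at this
    have hn10 : n * ε ≤ 10 * L := by
      have h1 : (n : ℝ) < 8 * L / ε + 1 := Nat.ceil_lt_add_one (by positivity)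
      have h2 : n * ε < (8 * L / ε + 1) * ε := by gcongr
      have h3 : (8 * L / ε + 1) * ε = 8 * L + ε := by field_simp
      linarith
    have hn : 1 ≤ n := Nat.ceil_pos.2 (by positivity)
    have hnη : 20 * n * (noiseScale k ε L)⁻¹ ≤ tailHeight k L := by
      rw [hη, hbr, ← mul_div_assoc, div_le_div_iff₀ (by positivity) (by positivity)]
      nlinarith
    have hn' : (1 : ℝ) ≤ n := by exact_mod_cast hn
    have hη0 : 0 < (noiseScale k ε L)⁻¹ := by positivity
    obtain ⟨hint, hmom⟩ := integral_prod_ratio_moment_le k hb (by linarith) hs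
      (by nlinarith) hn hnη
    have hexp2 : 2800 * k * n ^ 2 * (noiseScale k ε L)⁻¹ ^ 2 ≤ L / 2 := by
      rw [hη, div_pow, mul_pow, hr2, ← mul_div_assoc, div_le_iff₀ (by positivity)]
      have h1 : (n * ε) ^ 2 ≤ (10 * L) ^ 2 := by gcongr
      have h2 : (k : ℝ) * (n * ε) ^ 2 ≤ k * (10 * L) ^ 2 := by gcongr
      have h3 : 0 ≤ (k : ℝ) * L ^ 2 := by positivity
      nlinarith
    have hW := quarter_le_profileMass hb (by linarith)
    have hZ := noiseMass_pos k hb hb1 hκ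
    have hWZ := profileMass_pow_div_noiseMass_le k hb hb1 hκ
    rw [eight_mul_tailHeight_sq_mul hk hL0, min_eq_left hkL, div_le_iff₀ hZ] at hWZ
    have h := noiseMeasure_shift_le k (a := ε / 2) (δ := Real.exp (-L))
      hb hb1 hκ hs (hint.const_mul (Real.exp (-(n * (ε / 2 / 2))))) (fun t => ?_) ?_
      (fun t => prod_profile_sq_le_max k hb n s t) hT
    · rwa [hexp] at h
    · have hp : ∀ x, 0 < profile (tailHeight k L) x := profile_pos hb
      refine mul_nonneg (Real.exp_pos _).le (Finset.prod_nonneg fun i _ => ?_)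
      have := hp (t i)
      have := hp (t i + s i)
      positivity
    · rw [integral_const_mul]
      calc _ ≤ Real.exp (-(2 * L)) * ((Real.exp (L / 2) * noiseMass k (tailHeight k L)
              (ε * noiseScale k ε L / 2)) * Real.exp (L / 2)) := by
            refine mul_le_mul (Real.exp_le_exp.2 (by linarith)) (hmom.trans ?_)
              (integral_nonneg fun t => Finset.prod_nonneg fun i _ => ?_) (Real.exp_pos _).le
            · gcongr
            · have hp : ∀ x, 0 < profile (tailHeight k L) x := profile_pos hb
              have := hp (t i)
              have := hp (t i + s i)
              positivity
        _ = Real.exp (-L) * noiseMass k (tailHeight k L) (ε * noiseScale k ε L / 2) := by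
            have e : Real.exp (-L) = Real.exp (-(2 * L)) * Real.exp (L / 2) * Real.exp (L / 2) := by
              rw [← Real.exp_add, ← Real.exp_add]; ring_nf
            rw [e]; ring

lemma scaledNoise_real_norm_gt_le {k : ℕ} (hk : 1 ≤ k) {ε L : ℝ} (hε : 0 < ε)
    (hL : 1 / 2 ≤ L) :
    (scaledNoise k ε L).real {t | 2 < ‖t‖} ≤ Nat.factorial 20 / (k : ℝ) ^ 10 := by
  have hL0 : 0 < L := by linarith
  have hk' : (1 : ℝ) ≤ k := by exact_mod_cast hk
  have hR := noiseScale_pos hk hε hL0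
  have hb := tailHeight_pos hk hL0
  refine (noiseMeasure_real_norm_gt_le k hb (tailHeight_le k L) (by positivity)).trans ?_
  rw [eight_mul_tailHeight_sq_mul hk hL0]
  have hκ : ε * noiseScale k ε L / 2 = 500 * Real.sqrt (k * L) := by
    unfold noiseScale; field_simp; norm_num
  have hmin : min L k ≤ Real.sqrt (k * L) := by
    refine Real.le_sqrt_of_sq_le ?_
    rw [sq, mul_comm (k : ℝ)]
    exact mul_le_mul (min_le_left _ _) (min_le_right _ _) (le_min hL0.le (by linarith)) hL0.le
  have hsk : Real.sqrt k ≤ 2 * Real.sqrt (k * L) := by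
    refine Real.sqrt_le_iff.2 ⟨by positivity, ?_⟩
    rw [mul_pow, Real.sq_sqrt (by positivity)]
    nlinarith
  have hle : min L k / 2 - ε * noiseScale k ε L / 2 ≤ -Real.sqrt k := by
    rw [hκ]; linarith [Real.sqrt_nonneg (k * L)]
  refine (Real.exp_le_exp.2 hle).trans ?_
  have h1 := Real.pow_div_factorial_le_exp (Real.sqrt k) (Real.sqrt_nonneg _) 20
  have h2 : Real.sqrt k ^ 20 = (k : ℝ) ^ 10 := by
    rw [show 20 = 2 * 10 by norm_num, pow_mul, Real.sq_sqrt (by linarith)]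
  rw [h2] at h1
  rw [Real.exp_neg, ← inv_div]
  exact inv_anti₀ (by positivity) h1

/-! ### The mechanism -/

lemma abs_sub_le_one_of_sensitivity_le_one {X : Type*} {Nbr : X → X → Prop} {f : X → ℝ}
    (hf : sensitivity Nbr f ≤ 1) {x x' : X} (hx : Nbr x x') : |f x - f x'| ≤ 1 := by
  have h : ENNReal.ofReal |f x - f x'| ≤ 1 :=
    le_trans (le_iSup_of_le x (le_iSup_of_le x'
      (le_iSup (fun _ : Nbr x x' => ENNReal.ofReal |f x - f x'|) hx))) hf
  exact ENNReal.ofReal_le_one.1 h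

theorem mainTheorem2 :
    ∃ C₁ : ℝ, 0 < C₁ ∧ ∃ C₂ : ℝ, 0 < C₂ ∧
      ∀ (k : ℕ), 1 ≤ k → ∀ (ε δ : ℝ), 0 < ε → ε ≤ 1 → 0 < δ → δ ≤ 1 / 2 →
        ∀ (X : Type*) (Nbr : X → X → Prop),
          ∃ A : QueryAlgorithm X k,
            ∀ q : Fin k → X → ℝ, (∀ i, sensitivity Nbr (q i) ≤ 1) →
              IsDP Nbr ε δ (A q) ∧
              ∀ x : X,
                1 - C₂ / (k : ℝ) ^ 10 ≤
                  (A q x : Measure (Fin k → ℝ)).real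
                    {a | linftyError q x a ≤ C₁ * errorBound k ε δ} := by
  refine ⟨2000, by norm_num, Nat.factorial 20, by positivity, ?_⟩
  intro k hk ε δ hε hε1 hδ hδ1 X Nbr
  set L := Real.log (1 / δ) with hL_def
  have hL : 1 / 2 ≤ L := by
    have h1 : Real.log 2 ≤ L := Real.log_le_log (by norm_num) (by
      rw [le_div_iff₀ hδ]; linarith)
    linarith [Real.log_two_gt_d9]
  have hL0 : 0 < L := by linarith
  have hδL : Real.exp (-L) = δ := by
    rw [hL_def, one_div, Real.log_inv, neg_neg, Real.exp_log hδ]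
  set R := noiseScale k ε L with hR_def
  have hR : 0 < R := noiseScale_pos hk hε hL0
  have hprob : IsProbabilityMeasure (scaledNoise k ε L) :=
    isProbabilityMeasure_noiseMeasure k (tailHeight_pos hk hL0) (tailHeight_le k L)
      (by positivity)
  have hmeas : ∀ c : Fin k → ℝ, Measurable fun t : Fin k → ℝ => c + R • t := fun c => by fun_prop
  let A : QueryAlgorithm X k := fun q x =>
    ProbabilityMeasure.map ⟨scaledNoise k ε L, hprob⟩ (hmeas fun i => q i x).aemeasurable
  have hA : ∀ q x (S : Set (Fin k → ℝ)), MeasurableSet S → (A q x : Measure (Fin k → ℝ)).real S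
      = (scaledNoise k ε L).real {t | (fun i => q i x) + R • t ∈ S} := fun q x S hS => by
    change (Measure.map _ _).real S = _
    rw [map_measureReal_apply (hmeas _) hS]
    rfl
  refine ⟨A, fun q hq => ⟨fun x x' hx S hS => ?_, fun x => ?_⟩⟩
  · rw [hA q x S hS, hA q x' S hS, ← hδL]
    set s : Fin k → ℝ := R⁻¹ • ((fun i => q i x) - fun i => q i x') with hs_def
    have hs : ‖s‖ ≤ R⁻¹ := by
      rw [hs_def, norm_smul, Real.norm_of_nonneg (inv_pos.2 hR).le]
      refine mul_le_of_le_one_right (inv_pos.2 hR).le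
        ((pi_norm_le_iff_of_nonneg zero_le_one).2 fun i => ?_)
      exact abs_sub_le_one_of_sensitivity_le_one (hq i) hx
    have h := scaledNoise_shift_le hk hε hε1 hL hs (hmeas (fun i => q i x) hS)
    have e : {t : Fin k → ℝ | t - s ∈ (fun t => (fun i => q i x) + R • t) ⁻¹' S}
        = {t | (fun i => q i x') + R • t ∈ S} := by
      ext t
      have : (fun i => q i x) + R • (t - s) = (fun i => q i x') + R • t := by
        rw [hs_def, smul_sub, smul_inv_smul₀ hR.ne']; abel
      simp only [Set.mem_ofPred_eq, Set.mem_preimage, this]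
    rw [e] at h
    exact h
  · have herr : 2000 * errorBound k ε δ = R * 2 := by
      rw [errorBound, ← hL_def, hR_def, noiseScale]; ring
    have hSm : MeasurableSet {a | linftyError q x a ≤ 2000 * errorBound k ε δ} := by
      have : Continuous fun a : Fin k → ℝ => linftyError q x a := by
        unfold linftyError; fun_prop
      exact (isClosed_le this continuous_const).measurableSet
    rw [hA q x _ hSm]
    have e : {t : Fin k → ℝ | (fun i => q i x) + R • t
        ∈ {a | linftyError q x a ≤ 2000 * errorBound k ε δ}} = {t | 2 < ‖t‖}ᶜ := by
      ext t
      have h1 : linftyError q x ((fun i => q i x) + R • t) = R * ‖t‖ := by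
        have : (fun i => q i x - ((fun i => q i x) + R • t) i) = -(R • t) := by
          ext i; simp
        rw [linftyError, this, norm_neg, norm_smul, Real.norm_of_nonneg hR.le]
      simp only [Set.mem_ofPred_eq, Set.mem_compl_iff, not_lt, h1, herr]
      exact mul_le_mul_iff_right₀ hR
    rw [e, probReal_compl_eq_one_sub
      (isOpen_lt continuous_const continuous_norm).measurableSet]
    linarith [scaledNoise_real_norm_gt_le hk hε hL]
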